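/- Consider a multiple-access channel shared by $m$ stations with distinct ids $0,\dots,m-1$. Time is slotted. Each station keeps its packets in a first-in-first-out queue. In each slot every station decides, from its id, its own past local observations and the common clock, whether to transmit the first packet of its queue. A transmission succeeds (and the packet is delivered and leaves the queue) if and only if exactly one station transmits in that slot; after each slot every station learns whether there was a successful transmission. A protocol is a deterministic rule for these decisions; it may depend on the station's id (it is asymmetric). \emph{Round-Robin-Withholding} (RRW) is the deterministic algorithm in which station $0$ transmits from the first slot on until its queue is empty, and, for each $i$, station $i+1$ starts transmitting after the first silent slot that follows the last transmission of station $i$ (if station $i$ has no packets, its turn is a single silent slot). The \emph{framed RRW protocol with frame length $T\ge 1$} divides time into frames of $T$ slots and in each frame executes RRW from scratch, for $T$ slots, on all packets that are waiting at the beginning of the frame; packets injected during a frame wait at least until the next frame, and packets not delivered in a frame take part again in the next one. Injection models. (i) \emph{Stochastic injection of rate at most $\lambda$}: there are finitely many generators, each of which injects at most one packet per slot, at a random station; for each generator the distribution is the same in all slots, and the injections of different generators and of different slots are independent; the expected number of packets injected per slot is at most $\lambda$. (ii) \emph{$(w,\lambda)$-bounded adversary}, $w\ge 1$: in every interval of $w$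 consecutive slots at most $w\lambda$ packets are injected. The latency of a packet is the number of slots from its injection until its delivery ($\infty$ if it is never delivered). A protocol, started with empty queues, is \emph{stable} for an injection model if there is a finite constant $B$ such that, for every injection of this model, the expected number of undelivered packets at any time is at most $B$ and the expected latency of every packet (conditioned on its being injected) is at most $B$. Against an adversary the protocol is deterministic, so these bounds hold without expectation. \textbf{Statement.} Let $m\in\mathbb N$ and $\lambda<1$. \begin{enumerate} \item RRW delivers any $n$ packets that are initially distributed arbitrarily among the $m$ stations within $n+m$ slots. \item There is an asymmetric deterministic protocol, namely framed RRW for some frame length $T\ge1$, that is stable under stochastic injection of rate at most $\lambda$. \item For each $w\ge 1$ there is an asymmetric deterministic protocol, namely framed RRW for some frame length $T\ge1$, that is stable against all $(w,\lambda)$-bounded adversaries. \end{enumerate} -/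

import Mathlib

open MeasureTheory ProbabilityTheory
open scoped ENNReal

universe u

namespace MAC

/-- A deterministic distributed algorithm (protocol) for the multiple-access channel with stations
`0, …, m - 1`.  The algorithm may depend on the station id (it is asymmetric).  In every time slot a
station only uses its id, its own local state and the number of packets waiting in its own queue to
decide whether it transmits the packet at the head of its queue; afterwards it learns whether
there was a successful transmission on the channel (`true`) or not (`false`). All stations
start in slot `0`. -/
structure Protocol (m : ℕ) where
  State : Type
  init : Fin m → State
  send : Fin m → State → ℕ → Bool
  next : Fin m → State → ℕ → Bool → State

/-- The local states and the (first in, first out) queues at the beginning of a slot.  Packets are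
represented by their names, elements of `α`. -/
structure Config {m : ℕ} (P : Protocol m) (α : Type) where
  state : Fin m → P.State
  queue : Fin m → List α

variable {m : ℕ}

/-- Station `i` transmits in the current slot: it has a packet and decides to send. -/
def Config.transmits {P : Protocol m} {α : Type} (c : Config P α) (i : Fin m) : Prop :=
  c.queue i ≠ [] ∧ P.send i (c.state i) (c.queue i).length = true

instance {P : Protocol m} {α : Type} (c : Config P α) (i : Fin m) : Decidable (c.transmits i) :=
  decidable_of_iff (0 < (c.queue i).length ∧ P.send i (c.state i) (c.queue i).length = true) <| by
    simp [Config.transmits, List.length_pos_iff]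

/-- A transmission is successful if and only if exactly one station transmits. -/
def Config.success {P : Protocol m} {α : Type} (c : Config P α) : Bool :=
  decide ((Finset.univ.filter fun i => c.transmits i).card = 1)

/-- One time slot.  If exactly one station transmits, its transmitted packet is delivered and leaves
its queue; the packets `new i` injected at station `i` during the slot join the end of its queue. -/
def Config.step {P : Protocol m} {α : Type} (new : Fin m → List α) (c : Config P α) :
    Config P α where
  state i := P.next i (c.state i) (c.queue i).length c.success
  queue i :=
    (if c.success = true ∧ c.transmits i then (c.queue i).tail else c.queue i) ++ new i

/-- The configuration at the beginning of slot `t`, when the queues at the beginning of slot `0`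
are `q` and `new s i` are the packets injected at station `i` in slot `s`. -/
def run (P : Protocol m) {α : Type} (q : Fin m → List α) (new : ℕ → Fin m → List α) :
    ℕ → Config P α
  | 0 => ⟨P.init, q⟩
  | t + 1 => (run P q new t).step (new t)

/-! ### The static problem and Round-Robin-Withholding -/

/-- `P` delivers the packets initially stored in the queues `q` within `k` slots, when no further
packets are injected. -/
def DeliversWithin (P : Protocol m) {α : Type} (q : Fin m → List α) (k : ℕ) : Prop :=
  ∀ i, (run P q (fun _ _ => []) k).queue i = []

/-- Round-Robin-Withholding: every station counts the slots without a transmission.  Station `i`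
transmits as long as it has packets, starting after `i` such slots: an empty slot is the signal
that the next station takes over. -/
def roundRobinWithholding (m : ℕ) : Protocol m where
  State := ℕ
  init _ := 0
  send i s q := decide (s = (i : ℕ) ∧ 0 < q)
  next _ s _ heard := if heard then s else s + 1

/-- The state of a station in a protocol that repeatedly executes the algorithm `A` in frames: the
number of slots of the current frame that have elapsed, the number of the station's own packets
that the current execution of `A` still has to deliver, and the station's state in that
execution. -/
structure FrameState (A : Protocol m) where
  elapsed : ℕ
  remaining : ℕ
  inner : A.State

/-- The beginning of a slot: if it is the first slot of a frame, a new execution of `A` starts, on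
all packets that are waiting at that moment (`q` of them at station `i`). -/
def FrameState.refresh {A : Protocol m} (i : Fin m) (q : ℕ) (s : FrameState A) : FrameState A :=
  if s.elapsed = 0 then ⟨0, q, A.init i⟩ else s

/-- The dynamic protocol that divides time into frames of `T` slots and in each frame executes the
static algorithm `A` for `T` slots, on the packets that are waiting at the beginning of the frame.
Packets injected during a frame wait at least until the next frame; packets that could
not be delivered during a frame take part in the next frame again. -/
def framed (A : Protocol m) (T : ℕ) : Protocol m where
  State := FrameState A
  init i := ⟨0, 0, A.init i⟩
  send i s q :=
    let s' := s.refresh i q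
    decide (0 < s'.remaining) && A.send i s'.inner s'.remaining
  next i s q heard :=
    let s' := s.refresh i q
    { elapsed := (s'.elapsed + 1) % T
      remaining :=
        if (decide (0 < s'.remaining) && A.send i s'.inner s'.remaining && heard) = true then
          s'.remaining - 1 else s'.remaining
      inner := A.next i s'.inner s'.remaining heard }

/-! ### Dynamic injection -/

/-- An injection pattern with `G` packet generators: `x t g = some i` means that in slot `t`
generator `g` injects a packet at station `i`, and `x t g = none` that it injects nothing. The
packet is named `(t, g)`. -/
abbrev Injection (m G : ℕ) := ℕ → Fin G → Option (Fin m)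

/-- The packets injected at station `i` in slot `t`. -/
def Injection.new {G : ℕ} (x : Injection m G) (t : ℕ) (i : Fin m) : List (ℕ × Fin G) :=
  ((List.finRange G).filter fun g => decide (x t g = some i)).map fun g => (t, g)

/-- The configuration at the beginning of slot `t` if the system is initially empty. -/
def dynamics (P : Protocol m) {G : ℕ} (x : Injection m G) (t : ℕ) : Config P (ℕ × Fin G) :=
  run P (fun _ => []) x.new t

/-- The number of undelivered packets in the system at the beginning of slot `t`. -/
def backlog (P : Protocol m) {G : ℕ} (x : Injection m G) (t : ℕ) : ℕ :=
  ∑ i, ((dynamics P x t).queue i).length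

/-- The latency of the packet injected by generator `g` in slot `t`: the number of slots from its
injection until it has been delivered, `⊤` if this never happens. -/
noncomputable def latency (P : Protocol m) {G : ℕ} (x : Injection m G) (t : ℕ) (g : Fin G) : ℕ∞ :=
  ⨅ s ∈ {s : ℕ | t < s ∧ ∀ i, (t, g) ∉ (dynamics P x s).queue i}, ((s - t : ℕ) : ℕ∞)

/-- The interference matrix of the multiple-access channel: all entries are `1`. -/
def interference (m : ℕ) : Matrix (Fin m) (Fin m) ℝ := fun _ _ => 1

/-- Stochastic injection of rate at most `rate`: `X t g` is the random injection of generator `g` in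
slot `t`.  For each generator it is identically distributed in all slots, different generators
and different slots are independent, and for the vector `F` of the expected numbers of
packets per slot injected at the stations, each component of `W F` is at most `rate`. -/
structure IsStochasticInjection {Ω : Type*} [MeasurableSpace Ω] (μ : Measure Ω) {G : ℕ}
    (X : ℕ → Fin G → Ω → Option (Fin m)) (rate : ℝ) : Prop where
  measurable : ∀ t g, Measurable[_, ⊤] (X t g)
  identDistrib : ∀ t t' g i, μ {ω | X t g ω = some i} = μ {ω | X t' g ω = some i}
  indep : iIndepFun (m := fun _ => ⊤) (fun p : ℕ × Fin G => X p.1 p.2) μ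
  rate_le : ∀ t e, (interference m).mulVec
    (fun i => ∑ g, μ.real {ω | X t g ω = some i}) e ≤ rate

/-- Stability under stochastic injection of rate at most `rate`: the expected number of undelivered
packets at any time and the expected latency of every packet (given that it is injected) are
bounded, uniformly over all such injections. -/
def StochasticallyStable (P : Protocol m) (rate : ℝ) : Prop :=
  ∃ B : ℕ, ∀ (Ω : Type u) [MeasurableSpace Ω] (μ : Measure Ω) [IsProbabilityMeasure μ] (G : ℕ)
    (X : ℕ → Fin G → Ω → Option (Fin m)), IsStochasticInjection μ X rate →
      (∀ t, ∫⁻ ω, (backlog P (fun s g => X s g ω) t : ℝ≥0∞) ∂μ ≤ B) ∧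
      ∀ t g, ∫⁻ ω, ((latency P (fun s g' => X s g' ω) t g : ℕ∞) : ℝ≥0∞)
        ∂(μ[|{ω | X t g ω ≠ none}]) ≤ B

/-- A `(w, rate)`-bounded adversary: for each interval of `w` slots and the vector `R` of the numbers
of packets injected at the stations in it, each component of `W R` is at most `w * rate`. -/
def IsWindowBounded {G : ℕ} (x : Injection m G) (w : ℕ) (rate : ℝ) : Prop :=
  ∀ s e, (interference m).mulVec
    (fun i => ∑ t ∈ Finset.Ico s (s + w), ((x.new t i).length : ℝ)) e ≤ w * rate

/-- Stability against all `(w, rate)`-bounded adversaries: the number of undelivered packets at any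
time and the latency of every packet are bounded, uniformly over all such adversaries.  As the
protocol is deterministic, there is nothing to take the expectation over. -/
def AdversariallyStable (P : Protocol m) (w : ℕ) (rate : ℝ) : Prop :=
  ∃ B : ℕ, ∀ (G : ℕ) (x : Injection m G), IsWindowBounded x w rate →
    (∀ t, backlog P x t ≤ B) ∧ ∀ t g, x t g ≠ none → latency P x t g ≤ B

end MAC

/-! All stations hear the same feedback, so they agree on whose turn it is, and only that station
can transmit. Hence each slot either delivers a packet or passes the turn on, and the potential
"packets left plus turns left" drops by one per slot until it vanishes (`sum_serve_add_le`). It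
starts at `n + m`, which settles the static claim.

Within a frame of length `T ≥ m` the same potential shows that the backlog `n k` at frame starts
behaves like a single queue of capacity `c = T - m`: `n (k + 1) ≤ n k - c + A k`, where `A k` counts
the arrivals in frame `k` (`framed_backlog_succ_le`). A frame that starts with at most `c` packets
clears them all. The frame length is chosen so that `T * rate < c`. Against an adversary, `T` is
also a multiple of `w`; then `A k ≤ c`, so `n k ≤ c` forever and every packet leaves in the frame
after its injection.

In the stochastic case, tracing back to the start `j` of the busy period (`exists_busy_start`)
bounds the load by the excess of arrivals over capacity since `j`. As `j` is random, it is replaced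
by a sum over all `j` of exponential weights of the excess. By independence (a Chernoff bound) the
mean weight over `d` frames is at most `ρ ^ d` with `ρ < 1` depending only on `θ`, `T`, `m` and the
rate, so geometric series give uniform constants. Conditioning on the injection of a packet fixes a
single factor of the weight and costs at most `exp θ`. -/

namespace MAC

variable {m : ℕ}

/-! ### One slot of Round-Robin-Withholding -/

/-- The numbers of waiting packets after the station whose turn is `s` has been served. -/
def serve (s : ℕ) (r : Fin m → ℕ) (i : Fin m) : ℕ :=
  if (i : ℕ) = s then r i - 1 else r i

open Classical in
/-- The turn after a slot: it passes on if and only if the slot was silent. -/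
noncomputable def turn (s : ℕ) (r : Fin m → ℕ) : ℕ :=
  if ∃ i : Fin m, (i : ℕ) = s ∧ 0 < r i then s else s + 1

theorem serve_le (s : ℕ) (r : Fin m → ℕ) (i : Fin m) : serve s r i ≤ r i := by
  unfold serve; split <;> omega

theorem serve_eq_zero_of_lt_turn {s : ℕ} {r : Fin m → ℕ} (h : ∀ j : Fin m, (j : ℕ) < s → r j = 0)
    (j : Fin m) (hj : (j : ℕ) < turn s r) : serve s r j = 0 := by
  have hle := serve_le s r j
  unfold turn at hj
  split at hj
  · have := h j hj
    omega
  · next hn =>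
    rcases Nat.lt_succ_iff_lt_or_eq.mp hj with h1 | h1
    · have := h j h1
      omega
    · have : ¬ 0 < r j := fun h2 => hn ⟨j, h1, h2⟩
      omega

/-- A successful slot lowers the first summand, a silent one the second. Once `s ≥ m`, all queues
are empty by `h` and the potential is already zero. -/
theorem sum_serve_add_le {s : ℕ} {r : Fin m → ℕ} (h : ∀ j : Fin m, (j : ℕ) < s → r j = 0) :
    ∑ i, serve s r i + (m - turn s r) ≤ ∑ i, r i + (m - s) - 1 := by
  by_cases hx : ∃ i : Fin m, (i : ℕ) = s ∧ 0 < r i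
  · have ht : turn s r = s := by simp only [turn, if_pos hx]
    obtain ⟨i, hi, hr⟩ := hx
    have : ∑ j, serve s r j < ∑ j, r j :=
      Finset.sum_lt_sum (fun j _ => serve_le s r j)
        ⟨i, Finset.mem_univ _, by simp only [serve, if_pos hi]; omega⟩
    rw [ht]
    omega
  · have ht : turn s r = s + 1 := by simp only [turn, if_neg hx]
    have hle : ∑ j, serve s r j ≤ ∑ j, r j := Finset.sum_le_sum fun j _ => serve_le s r j
    rw [ht]
    rcases lt_or_ge s m with hs | hs
    · omega
    · have : ∑ j, r j = 0 := Finset.sum_eq_zero fun j _ => h j (by omega)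
      omega

/-- If only the station whose turn is `s` may transmit, then it is successful when it does. -/
theorem Config.success_iff {P : Protocol m} {α : Type} {c : Config P α} {s : ℕ} {r : Fin m → ℕ}
    (h : ∀ i, c.transmits i ↔ (i : ℕ) = s ∧ 0 < r i) :
    c.success = true ↔ ∃ i : Fin m, (i : ℕ) = s ∧ 0 < r i := by
  rw [Config.success, decide_eq_true_iff, Finset.card_eq_one]
  constructor
  · rintro ⟨i, hi⟩
    have : i ∈ Finset.univ.filter fun i => c.transmits i := by rw [hi]; simp
    exact ⟨i, (h i).1 (Finset.mem_filter.1 this).2⟩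
  · rintro ⟨i, hi, hr⟩
    refine ⟨i, ?_⟩
    ext j
    simp only [Finset.mem_filter, Finset.mem_univ, true_and, Finset.mem_singleton, h]
    constructor
    · rintro ⟨hj, -⟩
      exact Fin.ext (hj.trans hi.symm)
    · rintro rfl
      exact ⟨hi, hr⟩

theorem Config.success_and_transmits_iff {P : Protocol m} {α : Type} {c : Config P α} {s : ℕ}
    {r : Fin m → ℕ} (h : ∀ i, c.transmits i ↔ (i : ℕ) = s ∧ 0 < r i) (i : Fin m) :
    (c.success = true ∧ c.transmits i) ↔ (i : ℕ) = s ∧ 0 < r i := by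
  rw [Config.success_iff h, h]
  exact ⟨fun h => h.2, fun h => ⟨⟨i, h⟩, h⟩⟩

theorem turn_eq {P : Protocol m} {α : Type} {c : Config P α} {s : ℕ} {r : Fin m → ℕ}
    (h : ∀ i, c.transmits i ↔ (i : ℕ) = s ∧ 0 < r i) :
    turn s r = if c.success = true then s else s + 1 := by
  simp only [turn, Config.success_iff h]

/-! ### The static problem -/

/-- The common feedback keeps the local counters equal, so there is a well-defined turn `s`, and the
potential argument applies slot by slot. -/
theorem roundRobinWithholding_run {α : Type} (q : Fin m → List α) (k : ℕ) :
    ∃ s : ℕ, (∀ i, (run (roundRobinWithholding m) q (fun _ _ => []) k).state i = s) ∧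
      (∀ j : Fin m, (j : ℕ) < s →
        ((run (roundRobinWithholding m) q (fun _ _ => []) k).queue j).length = 0) ∧
      ∑ i, ((run (roundRobinWithholding m) q (fun _ _ => []) k).queue i).length + (m - s) ≤
        ∑ i, (q i).length + m - k := by
  induction k with
  | zero => exact ⟨0, fun _ => rfl, fun j hj => absurd hj (Nat.not_lt_zero _), by simp [run]⟩
  | succ k ih =>
    obtain ⟨s, hs, h0, hsum⟩ := ih
    set c := run (roundRobinWithholding m) q (fun _ _ => []) k with hc
    have htr : ∀ i, c.transmits i ↔ (i : ℕ) = s ∧ 0 < (c.queue i).length := by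
      intro i
      simp only [Config.transmits, roundRobinWithholding, decide_eq_true_iff]
      have := hs i
      rw [List.length_pos_iff]
      constructor
      · rintro ⟨h1, h2, -⟩
        exact ⟨h2.symm.trans this, h1⟩
      · rintro ⟨h1, h2⟩
        exact ⟨h2, this.trans h1.symm, h2⟩
    have hq : ∀ i, ((run (roundRobinWithholding m) q (fun _ _ => []) (k + 1)).queue i).length =
        serve s (fun i => (c.queue i).length) i := by
      intro i
      simp only [run, ← hc, Config.step, Config.success_and_transmits_iff htr, List.append_nil,
        serve]
      by_cases h1 : (i : ℕ) = s
      · by_cases h2 : 0 < (c.queue i).length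
        · rw [if_pos ⟨h1, h2⟩, if_pos h1, List.length_tail]
        · rw [if_neg fun h => h2 h.2, if_pos h1]
          omega
      · rw [if_neg fun h => h1 h.1, if_neg h1]
    refine ⟨turn s (fun i => (c.queue i).length), fun i => ?_, fun j hj => ?_, ?_⟩
    · rw [turn_eq htr]
      change (if c.success = true then c.state i else Nat.succ (c.state i)) = _
      rw [hs i]
      rfl
    · rw [hq]
      exact serve_eq_zero_of_lt_turn h0 j hj
    · simp only [hq]
      have := sum_serve_add_le h0
      omega

theorem roundRobinWithholding_deliversWithin {α : Type} (q : Fin m → List α) :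
    DeliversWithin (roundRobinWithholding m) q ((∑ i, (q i).length) + m) := by
  intro i
  obtain ⟨s, -, -, h⟩ := roundRobinWithholding_run q ((∑ i, (q i).length) + m)
  rw [Nat.sub_self, Nat.le_zero, Nat.add_eq_zero_iff, Finset.sum_eq_zero_iff] at h
  exact List.length_eq_zero_iff.1 (h.1 i (Finset.mem_univ _))

/-! ### Framed Round-Robin-Withholding -/

/-- The packets injected at station `i` in the `e` slots from slot `t` on. -/
def Injection.during {G : ℕ} (x : Injection m G) (t e : ℕ) (i : Fin m) : List (ℕ × Fin G) :=
  (List.range e).flatMap fun u => x.new (t + u) i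

/-- The number of packets injected in slot `t`. -/
def Injection.arrivals {G : ℕ} (x : Injection m G) (t : ℕ) : ℕ :=
  (Finset.univ.filter fun g => x t g ≠ none).card

theorem Injection.length_new {G : ℕ} (x : Injection m G) (t : ℕ) (i : Fin m) :
    (x.new t i).length = (Finset.univ.filter fun g => x t g = some i).card := by
  rw [Injection.new, List.length_map, ← List.toFinset_card_of_nodup
    ((List.nodup_finRange G).filter _)]
  congr 1
  ext g
  simp

theorem Injection.sum_length_new {G : ℕ} (x : Injection m G) (t : ℕ) :
    ∑ i, (x.new t i).length = x.arrivals t := by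
  simp only [Injection.length_new, Injection.arrivals]
  rw [← Finset.card_biUnion]
  · congr 1
    ext g
    simp [Option.ne_none_iff_exists']
  · intro i _ j _ hij
    rw [Function.onFun, Finset.disjoint_left]
    intro g hi hj
    simp only [Finset.mem_filter, Finset.mem_univ, true_and] at hi hj
    exact hij (Option.some.inj (hi.symm.trans hj))

theorem Injection.fst_of_mem_new {G : ℕ} {x : Injection m G} {t : ℕ} {i : Fin m}
    {p : ℕ × Fin G} (h : p ∈ x.new t i) : p.1 = t := by
  simp only [Injection.new, List.mem_map] at h
  obtain ⟨g, -, rfl⟩ := h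
  rfl

theorem Injection.le_fst_of_mem_during {G : ℕ} {x : Injection m G} {t e : ℕ} {i : Fin m}
    {p : ℕ × Fin G} (h : p ∈ x.during t e i) : t ≤ p.1 := by
  simp only [Injection.during, List.mem_flatMap] at h
  obtain ⟨u, -, hu⟩ := h
  rw [Injection.fst_of_mem_new hu]
  omega

theorem Injection.sum_length_during {G : ℕ} (x : Injection m G) (t e : ℕ) :
    ∑ i, (x.during t e i).length = ∑ u ∈ Finset.Ico t (t + e), x.arrivals u := by
  induction e with
  | zero => simp [Injection.during]
  | succ e ih =>
    rw [← add_assoc, Finset.sum_Ico_succ_top (by omega), ← ih, ← x.sum_length_new,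
      ← Finset.sum_add_distrib]
    refine Finset.sum_congr rfl fun i _ => ?_
    simp [Injection.during, List.range_succ]

/-- One slot of framed Round-Robin-Withholding, in terms of the refreshed local states. -/
theorem framed_step {T : ℕ} {α : Type} {c : Config (framed (roundRobinWithholding m) T) α}
    {e s : ℕ} {r : Fin m → ℕ}
    (hst : ∀ i, (c.state i).refresh i (c.queue i).length = ⟨e, r i, s⟩)
    (hr : ∀ i, r i ≤ (c.queue i).length) (new : Fin m → List α) (i : Fin m) :
    (c.step new).state i = ⟨(e + 1) % T, serve s r i, turn s r⟩ ∧
      (c.step new).queue i =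
        (if (i : ℕ) = s ∧ 0 < r i then (c.queue i).tail else c.queue i) ++ new i := by
  have htr : ∀ i, c.transmits i ↔ (i : ℕ) = s ∧ 0 < r i := by
    intro i
    simp only [Config.transmits, framed, hst]
    simp only [roundRobinWithholding, Bool.and_eq_true, decide_eq_true_iff]
    have := hr i
    rw [← List.length_pos_iff]
    omega
  constructor
  · have hsuc := Config.success_iff htr
    rw [turn_eq htr]
    simp only [Config.step, framed, hst]
    simp only [roundRobinWithholding]
    congr 1
    simp only [Bool.and_eq_true, decide_eq_true_iff, serve]
    by_cases h1 : (i : ℕ) = s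
    · by_cases h2 : 0 < r i
      · rw [if_pos ⟨⟨h2, h1.symm, h2⟩, hsuc.2 ⟨i, h1, h2⟩⟩, if_pos h1]
      · rw [if_neg fun h => h2 h.1.1, if_pos h1]
        omega
    · rw [if_neg fun h => h1 h.1.2.1.symm, if_neg h1]
  · simp only [Config.step, Config.success_and_transmits_iff htr]

/-- The situation after `e` slots of the frame that starts in slot `t`. -/
structure FrameInvariant (T : ℕ) {G : ℕ} (x : Injection m G) (t e s : ℕ) (r : Fin m → ℕ) :
    Prop where
  queue : ∀ i, ∃ old : List (ℕ × Fin G), old.length = r i ∧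
    (dynamics (framed (roundRobinWithholding m) T) x (t + e)).queue i = old ++ x.during t e i
  zero : ∀ j : Fin m, (j : ℕ) < s → r j = 0
  sum_le : ∑ i, r i ≤ backlog (framed (roundRobinWithholding m) T) x t
  sum_add_le : ∑ i, r i + (m - s) ≤ backlog (framed (roundRobinWithholding m) T) x t + m - e

/-- The current execution removes packets only from the prefix `old` of each queue, while new
packets join at the end. Phrasing `hst` with refreshed states treats the first slot of a frame like
the others. -/
theorem FrameInvariant.step {T : ℕ} {G : ℕ} {x : Injection m G} {t e s : ℕ} {r : Fin m → ℕ}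
    (h : FrameInvariant T x t e s r)
    (hst : ∀ i, ((dynamics (framed (roundRobinWithholding m) T) x (t + e)).state i).refresh i
      ((dynamics (framed (roundRobinWithholding m) T) x (t + e)).queue i).length = ⟨e, r i, s⟩) :
    FrameInvariant T x t (e + 1) (turn s r) (serve s r) ∧
      ∀ i, (dynamics (framed (roundRobinWithholding m) T) x (t + (e + 1))).state i =
        ⟨(e + 1) % T, serve s r i, turn s r⟩ := by
  have hr : ∀ i, r i ≤
      ((dynamics (framed (roundRobinWithholding m) T) x (t + e)).queue i).length := by
    intro i
    obtain ⟨old, ho, hq⟩ := h.queue i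
    rw [hq, List.length_append]
    omega
  have key := fun i => framed_step hst hr (x.new (t + e)) i
  refine ⟨⟨fun i => ?_, serve_eq_zero_of_lt_turn h.zero,
    (Finset.sum_le_sum fun i _ => serve_le s r i).trans h.sum_le, ?_⟩, fun i => (key i).1⟩
  · obtain ⟨old, ho, hq⟩ := h.queue i
    have hd : x.during t (e + 1) i = x.during t e i ++ x.new (t + e) i := by
      simp [Injection.during, List.range_succ]
    have hk := (key i).2
    change (dynamics (framed (roundRobinWithholding m) T) x (t + (e + 1))).queue i = _ at hk
    rw [hk, hq, hd]
    by_cases hi : (i : ℕ) = s ∧ 0 < r i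
    · refine ⟨old.tail, by simp [serve, hi.1, ho], ?_⟩
      have : old ≠ [] := by
        rw [← List.length_pos_iff]
        omega
      rw [if_pos hi, List.tail_append_of_ne_nil this, List.append_assoc]
    · refine ⟨old, ?_, by rw [if_neg hi, List.append_assoc]⟩
      rw [ho, serve]
      split
      · have : ¬ 0 < r i := fun h' => hi ⟨‹_›, h'⟩
        omega
      · rfl
  · have := sum_serve_add_le h.zero
    have := h.sum_add_le
    omega

/-- Each frame starts with all stations having elapsed time `0`, and all intermediate slots satisfy
the frame invariant. -/
theorem framed_frame {T : ℕ} {G : ℕ} {x : Injection m G} {t : ℕ}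
    (h0 : ∀ i, ((dynamics (framed (roundRobinWithholding m) T) x t).state i).elapsed = 0)
    {e : ℕ} (he : e < T) : ∃ s r, FrameInvariant T x t e s r ∧
      ∀ i, ((dynamics (framed (roundRobinWithholding m) T) x (t + e)).state i).refresh i
        ((dynamics (framed (roundRobinWithholding m) T) x (t + e)).queue i).length =
          ⟨e, r i, s⟩ := by
  induction e with
  | zero =>
    refine ⟨0, fun i => ((dynamics (framed (roundRobinWithholding m) T) x t).queue i).length,
      ⟨fun i => ⟨_, rfl, by simp [Injection.during]⟩, fun j hj => absurd hj (Nat.not_lt_zero _),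
        le_rfl, by simp [backlog]⟩, fun i => ?_⟩
    simp only [add_zero]
    exact if_pos (h0 i)
  | succ e ih =>
    obtain ⟨s, r, hinv, hst⟩ := ih (by omega)
    obtain ⟨h1, h2⟩ := hinv.step hst
    refine ⟨_, _, h1, fun i => ?_⟩
    -- The elapsed time `e + 1` is neither wrapped to zero nor zero, so refreshing changes nothing.
    rw [h2, Nat.mod_eq_of_lt he]
    simp [FrameState.refresh]

/-- Separate from `framed_frame`, because after `T` slots the counter wraps to `0` and refreshing
would start a new execution. -/
theorem framed_frame_end {T : ℕ} (hT : 0 < T) {G : ℕ} {x : Injection m G} {t : ℕ}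
    (h0 : ∀ i, ((dynamics (framed (roundRobinWithholding m) T) x t).state i).elapsed = 0) :
    (∃ s r, FrameInvariant T x t T s r) ∧
      ∀ i, ((dynamics (framed (roundRobinWithholding m) T) x (t + T)).state i).elapsed = 0 := by
  obtain ⟨s, r, hinv, hst⟩ := framed_frame h0 (e := T - 1) (by omega)
  obtain ⟨h1, h2⟩ := hinv.step hst
  rw [Nat.sub_add_cancel hT] at h1 h2
  exact ⟨⟨_, _, h1⟩, fun i => by rw [h2]; simp⟩

theorem framed_elapsed {T : ℕ} (hT : 0 < T) {G : ℕ} (x : Injection m G) (k : ℕ) (i : Fin m) :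
    ((dynamics (framed (roundRobinWithholding m) T) x (k * T)).state i).elapsed = 0 := by
  induction k generalizing i with
  | zero => simp [dynamics, run, framed]
  | succ k ih =>
    rw [Nat.succ_mul]
    exact (framed_frame_end hT ih).2 i

theorem FrameInvariant.backlog_eq {T : ℕ} {G : ℕ} {x : Injection m G} {t e s : ℕ}
    {r : Fin m → ℕ} (h : FrameInvariant T x t e s r) :
    backlog (framed (roundRobinWithholding m) T) x (t + e) =
      ∑ i, r i + ∑ u ∈ Finset.Ico t (t + e), x.arrivals u := by
  rw [← Injection.sum_length_during, ← Finset.sum_add_distrib, backlog]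
  refine Finset.sum_congr rfl fun i _ => ?_
  obtain ⟨old, ho, hq⟩ := h.queue i
  rw [hq, List.length_append, ho]

/-! ### The backlog from frame to frame -/

/-- The number of packets injected during frame `k`. -/
def Injection.frameArrivals {G : ℕ} (x : Injection m G) (T k : ℕ) : ℕ :=
  ∑ u ∈ Finset.Ico (k * T) ((k + 1) * T), x.arrivals u

/-- The potential is at most backlog plus `m` minus `T` at the end of the frame, so up to `m` slots
are lost to silence and `T - m` is the guaranteed capacity. -/
theorem framed_backlog_succ_le {T : ℕ} (hT : 0 < T) (hm : m ≤ T) {G : ℕ} (x : Injection m G)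
    (k : ℕ) : backlog (framed (roundRobinWithholding m) T) x ((k + 1) * T) ≤
      backlog (framed (roundRobinWithholding m) T) x (k * T) - (T - m) + x.frameArrivals T k := by
  obtain ⟨⟨s, r, h⟩, -⟩ := framed_frame_end hT (framed_elapsed hT x k)
  have h1 := h.backlog_eq
  have h2 := h.sum_add_le
  rw [Injection.frameArrivals, Nat.succ_mul, h1]
  omega

theorem framed_backlog_le {T : ℕ} (hT : 0 < T) {G : ℕ} (x : Injection m G) (t : ℕ) :
    backlog (framed (roundRobinWithholding m) T) x t ≤
      backlog (framed (roundRobinWithholding m) T) x (t / T * T) + x.frameArrivals T (t / T) := by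
  obtain ⟨s, r, h, -⟩ := framed_frame (framed_elapsed hT x (t / T)) (Nat.mod_lt t hT)
  have h1 := h.backlog_eq
  have h2 := h.sum_le
  have ht : t / T * T + t % T = t := Nat.div_add_mod' t T
  rw [ht] at h1
  have h3 : ∑ u ∈ Finset.Ico (t / T * T) t, x.arrivals u ≤ x.frameArrivals T (t / T) := by
    refine Finset.sum_le_sum_of_subset (Finset.Ico_subset_Ico le_rfl ?_)
    have := Nat.mod_lt t hT
    rw [Nat.succ_mul]
    omega
  omega

/-- A frame that starts with at most `T - m` packets delivers all of them. -/
theorem framed_delivered {T : ℕ} (hT : 0 < T) {G : ℕ} (x : Injection m G) (k : ℕ)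
    (hk : backlog (framed (roundRobinWithholding m) T) x (k * T) ≤ T - m) (hm : m ≤ T) {t : ℕ}
    (ht : t < k * T) (g : Fin G) (i : Fin m) :
    (t, g) ∉ (dynamics (framed (roundRobinWithholding m) T) x ((k + 1) * T)).queue i := by
  obtain ⟨⟨s, r, h⟩, -⟩ := framed_frame_end hT (framed_elapsed hT x k)
  obtain ⟨old, ho, hq⟩ := h.queue i
  have h2 := h.sum_add_le
  have h3 : r i ≤ ∑ i, r i := Finset.single_le_sum (fun _ _ => Nat.zero_le _) (Finset.mem_univ i)
  -- By `hk` and `hm` the potential has reached zero; whatever is queued was injected during this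
  -- frame.
  have h4 : old = [] := List.length_eq_zero_iff.1 (by omega)
  rw [Nat.succ_mul, hq, h4, List.nil_append]
  intro hmem
  have := Injection.le_fst_of_mem_during hmem
  simp only at this
  omega

/-- A packet injected before a frame that starts with at most `T - m` packets is delivered by the
end of this frame. -/
theorem framed_latency_le {T : ℕ} (hT : 0 < T) {G : ℕ} (x : Injection m G) (k : ℕ)
    (hk : backlog (framed (roundRobinWithholding m) T) x (k * T) ≤ T - m) (hm : m ≤ T) {t : ℕ}
    (ht : t < k * T) (g : Fin G) :
    latency (framed (roundRobinWithholding m) T) x t g ≤ (((k + 1) * T - t : ℕ) : ℕ∞) := by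
  refine iInf₂_le (α := ℕ∞) ((k + 1) * T) ⟨?_, framed_delivered hT x k hk hm ht g⟩
  rw [Nat.succ_mul]
  omega

/-! ### Sample path bounds -/

theorem Injection.sum_frameArrivals {G : ℕ} (x : Injection m G) (T : ℕ) {j l : ℕ} (h : j ≤ l) :
    ∑ i ∈ Finset.Ico j l, x.frameArrivals T i = ∑ u ∈ Finset.Ico (j * T) (l * T), x.arrivals u := by
  induction l, h using Nat.le_induction with
  | base => simp
  | succ l h ih =>
    rw [Finset.sum_Ico_succ_top h, ih, Injection.frameArrivals,
      Finset.sum_Ico_consecutive _ (Nat.mul_le_mul_right T h)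
        (Nat.mul_le_mul_right T (Nat.le_succ l))]

/-- The start of the current busy period of a queue with capacity `c` per step. -/
theorem exists_busy_start {c : ℕ} {n A : ℕ → ℕ} (h0 : n 0 ≤ c)
    (h : ∀ k, n (k + 1) ≤ n k - c + A k) (k : ℕ) :
    ∃ j ≤ k, n j ≤ c ∧ (∀ i, j < i → i ≤ k → c < n i) ∧
      n k + A k + c * (k - j) ≤ c + ∑ i ∈ Finset.Ico j (k + 1), A i := by
  induction k with
  | zero => exact ⟨0, le_rfl, h0, fun i h1 h2 => by omega, by simpa using h0⟩
  | succ k ih =>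
    rcases le_or_gt (n (k + 1)) c with hc | hc
    · exact ⟨k + 1, le_rfl, hc, fun i h1 h2 => by omega, by simpa using hc⟩
    · obtain ⟨j, hj, hn, hb, hs⟩ := ih
      refine ⟨j, by omega, hn, fun i h1 h2 => ?_, ?_⟩
      · rcases Nat.le_succ_iff.1 h2 with h3 | rfl
        · exact hb i h1 h3
        · exact hc
      · rw [Finset.sum_Ico_succ_top (by omega : j ≤ k + 1), Nat.succ_sub hj, Nat.mul_succ]
        have := h k
        -- The subtraction `n k - c` is truncated only if `n k ≤ c`, which forces `j = k`; the extra
        -- `c` on the right absorbs this single loss.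
        rcases le_or_gt (n k) c with h4 | h4
        · rcases eq_or_lt_of_le hj with rfl | h5
          · simp only [Finset.sum_Ico_succ_top (le_refl j), Finset.Ico_self, Finset.sum_empty,
              Nat.sub_self, Nat.mul_zero]
            omega
          · have := hb k h5 le_rfl
            omega
        · omega

/-- The exponential weight of the excess of the arrivals in the frames `j, …, l - 1` over the
capacity `c` per frame. -/
noncomputable def excessWeight (θ : ℝ) (c T : ℕ) {G : ℕ} (x : Injection m G) (j l : ℕ) : ℝ≥0∞ :=
  ENNReal.ofReal (Real.exp
    (θ * (((∑ u ∈ Finset.Ico (j * T) (l * T), x.arrivals u : ℕ) : ℝ) - c * ((l - j : ℕ) : ℝ))))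

/-- The start of the busy period depends on the sample path; summing over all possible starts gives
a bound whose mean can be computed term by term. -/
theorem framed_frame_load_le {T : ℕ} (hT : 0 < T) (hm : m ≤ T) {θ : ℝ} (hθ : 0 < θ) {G : ℕ}
    (x : Injection m G) (k : ℕ) :
    ((backlog (framed (roundRobinWithholding m) T) x (k * T) + x.frameArrivals T k : ℕ) : ℝ≥0∞) ≤
      2 * T + ENNReal.ofReal θ⁻¹ *
        ∑ j ∈ Finset.range (k + 1), excessWeight θ (T - m) T x j (k + 1) := by
  obtain ⟨j, hj, -, -, hs⟩ := exists_busy_start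
    (n := fun k => backlog (framed (roundRobinWithholding m) T) x (k * T))
    (by simp [backlog, dynamics, run]) (framed_backlog_succ_le hT hm x) k
  rw [x.sum_frameArrivals T (by omega : j ≤ k + 1)] at hs
  have hle : excessWeight θ (T - m) T x j (k + 1) ≤
      ∑ j ∈ Finset.range (k + 1), excessWeight θ (T - m) T x j (k + 1) :=
    Finset.single_le_sum (f := fun j => excessWeight θ (T - m) T x j (k + 1))
      (fun _ _ => zero_le) (Finset.mem_range.2 (by omega))
  refine le_trans ?_ (add_le_add_right (mul_le_mul_right hle _) _)
  have h2 : (2 * T : ℝ≥0∞) = ENNReal.ofReal (2 * T) := by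
    rw [ENNReal.ofReal_mul (by norm_num), ENNReal.ofReal_natCast]
    norm_num
  rw [excessWeight, h2, ← ENNReal.ofReal_mul (by positivity),
    ← ENNReal.ofReal_add (by positivity) (by positivity), ← ENNReal.ofReal_natCast]
  refine ENNReal.ofReal_le_ofReal ?_
  set S := ∑ u ∈ Finset.Ico (j * T) ((k + 1) * T), x.arrivals u
  have hN : backlog (framed (roundRobinWithholding m) T) x (k * T) + x.frameArrivals T k +
      (T - m) * (k + 1 - j) ≤ 2 * T + S := by
    have : (T - m) * (k + 1 - j) = (T - m) * (k - j) + (T - m) := by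
      rw [Nat.succ_sub hj, Nat.mul_succ]
    omega
  have hR : ((backlog (framed (roundRobinWithholding m) T) x (k * T) + x.frameArrivals T k : ℕ)
      : ℝ) + ((T - m : ℕ) : ℝ) * ((k + 1 - j : ℕ) : ℝ) ≤ 2 * T + (S : ℝ) := by exact_mod_cast hN
  set y : ℝ := (S : ℝ) - ((T - m : ℕ) : ℝ) * ((k + 1 - j : ℕ) : ℝ) with hy
  -- From `θ * y + 1 ≤ exp (θ * y)`: the exponential moment controls the first moment.
  have hexp : y ≤ θ⁻¹ * Real.exp (θ * y) := by
    rw [inv_mul_eq_div, le_div_iff₀ hθ, mul_comm]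
    linarith [Real.add_one_le_exp (θ * y)]
  linarith

/-- The busy period containing frame `l` starts at some `j ≤ k`, and since then arrivals have at
least matched capacity, so the weight for this `j` is at least `1`. The sum thus dominates the
indicator of the busy event. -/
theorem framed_one_le_of_busy {T : ℕ} (hT : 0 < T) (hm : m ≤ T) {θ : ℝ} (hθ : 0 < θ) {G : ℕ}
    (x : Injection m G) {k l : ℕ} (hkl : k < l) (hb : ∀ i, k < i → i ≤ l →
      T - m < backlog (framed (roundRobinWithholding m) T) x (i * T)) :
    1 ≤ ∑ j ∈ Finset.range (k + 1), excessWeight θ (T - m) T x j l := by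
  obtain ⟨j, hj, hn, -, hs⟩ := exists_busy_start
    (n := fun k => backlog (framed (roundRobinWithholding m) T) x (k * T))
    (by simp [backlog, dynamics, run]) (framed_backlog_succ_le hT hm x) l
  have hjk : j ≤ k := by
    by_contra hc
    have := hb j (by omega) hj
    omega
  rw [Finset.sum_Ico_succ_top hj, x.sum_frameArrivals T hj] at hs
  have hl := hb l hkl le_rfl
  have hle : excessWeight θ (T - m) T x j l ≤
      ∑ j ∈ Finset.range (k + 1), excessWeight θ (T - m) T x j l :=
    Finset.single_le_sum (f := fun j => excessWeight θ (T - m) T x j l)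
      (fun _ _ => zero_le) (Finset.mem_range.2 (by omega))
  refine le_trans ?_ hle
  rw [excessWeight, ENNReal.one_le_ofReal, Real.one_le_exp_iff]
  refine mul_nonneg hθ.le (sub_nonneg.2 ?_)
  have hN : (T - m) * (l - j) ≤ ∑ u ∈ Finset.Ico (j * T) (l * T), x.arrivals u := by omega
  exact_mod_cast hN

/-- If `d` busy frames follow the frame of injection, the latency is at most `T * (2 + d)`: the
injection frame, the busy frames and the clearing one. Each busy frame contributes at least `1` to
the series. -/
theorem framed_latency_le_tsum {T : ℕ} (hT : 0 < T) (hm : m ≤ T) {θ : ℝ} (hθ : 0 < θ) {G : ℕ}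
    (x : Injection m G) (t : ℕ) (g : Fin G) :
    ((latency (framed (roundRobinWithholding m) T) x t g : ℕ∞) : ℝ≥0∞) ≤
      T * (2 + ∑' r, ∑ j ∈ Finset.range (t / T + 1),
        excessWeight θ (T - m) T x j (t / T + 1 + r)) := by
  set k := t / T with hk
  have ht : t < (k + 1) * T := by
    have h := Nat.div_add_mod' t T
    rw [← hk] at h
    have := Nat.mod_lt t hT
    rw [Nat.succ_mul]
    omega
  have ht' : k * T ≤ t := Nat.div_mul_le_self t T
  have hsum : ∀ d, (∀ i, i < d →
      T - m < backlog (framed (roundRobinWithholding m) T) x ((k + 1 + i) * T)) →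
      (d : ℝ≥0∞) ≤ ∑' r, ∑ j ∈ Finset.range (k + 1),
        excessWeight θ (T - m) T x j (k + 1 + r) := by
    intro d hd
    refine le_trans ?_ (ENNReal.sum_le_tsum (Finset.range d))
    calc (d : ℝ≥0∞) = ∑ r ∈ Finset.range d, 1 := by simp
      _ ≤ _ := Finset.sum_le_sum fun r hr => by
        refine framed_one_le_of_busy hT hm hθ x (by omega) fun i h1 h2 => ?_
        obtain ⟨i', rfl⟩ := Nat.exists_eq_add_of_le (Nat.succ_le_of_lt h1)
        exact hd i' (by have := Finset.mem_range.1 hr; omega)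
  by_cases hex : ∃ d, backlog (framed (roundRobinWithholding m) T) x ((k + 1 + d) * T) ≤ T - m
  · classical
    have hd := Nat.find_spec hex
    have hmin := fun i (hi : i < Nat.find hex) => not_le.1 (Nat.find_min hex hi)
    set d := Nat.find hex
    have hlat := framed_latency_le hT x (k + 1 + d) hd hm (t := t)
      (ht.trans_le (Nat.mul_le_mul_right T (by omega))) g
    have hnat : (k + 1 + d + 1) * T - t ≤ T * (2 + d) := by
      have : (k + 1 + d + 1) * T = k * T + T * (2 + d) := by ring
      omega
    calc ((latency (framed (roundRobinWithholding m) T) x t g : ℕ∞) : ℝ≥0∞)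
        ≤ (((T * (2 + d) : ℕ) : ℕ∞) : ℝ≥0∞) :=
          ENat.toENNReal_le.2 (hlat.trans (by exact_mod_cast hnat))
      _ = T * (2 + d) := by rw [ENat.toENNReal_coe]; push_cast; rfl
      _ ≤ _ := by gcongr; exact hsum d hmin
  -- If all later frames are busy, the series diverges and the bound is trivial.
  · have htop : ∑' r, ∑ j ∈ Finset.range (k + 1),
        excessWeight θ (T - m) T x j (k + 1 + r) = ⊤ := by
      refine ENNReal.eq_top_of_forall_nnreal_le fun r => ?_
      obtain ⟨d, hd⟩ := exists_nat_ge r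
      refine le_trans ?_ (hsum d fun i _ => not_le.1 fun h => hex ⟨i, h⟩)
      exact_mod_cast hd
    rw [htop, add_top, ENNReal.mul_top (by exact_mod_cast hT.ne')]
    exact le_top

/-! ### Adversarial injection -/

theorem IsWindowBounded.sum_arrivals_le {G : ℕ} {x : Injection m G} {w : ℕ} {rate : ℝ}
    (h : IsWindowBounded x w rate) (hr : 0 ≤ rate) (s : ℕ) :
    ((∑ t ∈ Finset.Ico s (s + w), x.arrivals t : ℕ) : ℝ) ≤ w * rate := by
  -- Without stations the matrix has no row to read the bound from; then `0 ≤ rate` suffices.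
  rcases Nat.eq_zero_or_pos m with rfl | hm
  · have : ∀ t, x.arrivals t = 0 := fun t => by rw [← x.sum_length_new]; rfl
    simp only [this, Finset.sum_const_zero, Nat.cast_zero]
    positivity
  · have := h s ⟨0, hm⟩
    simp only [interference, Matrix.mulVec, dotProduct, one_mul] at this
    rw [Finset.sum_comm] at this
    simpa only [← x.sum_length_new, Nat.cast_sum] using this

theorem IsWindowBounded.sum_arrivals_mul_le {G : ℕ} {x : Injection m G} {w : ℕ} {rate : ℝ}
    (h : IsWindowBounded x w rate) (hr : 0 ≤ rate) (s n : ℕ) :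
    ((∑ t ∈ Finset.Ico s (s + n * w), x.arrivals t : ℕ) : ℝ) ≤ (n * w : ℕ) * rate := by
  induction n with
  | zero => simp
  | succ n ih =>
    rw [Nat.succ_mul, ← add_assoc, ← Finset.sum_Ico_consecutive _ (Nat.le_add_right s (n * w))
      (Nat.le_add_right _ w)]
    have := h.sum_arrivals_le hr (s + n * w)
    push_cast at this ih ⊢
    linarith

theorem IsWindowBounded.mono {G : ℕ} {x : Injection m G} {w : ℕ} {rate rate' : ℝ}
    (h : IsWindowBounded x w rate) (hr : rate ≤ rate') : IsWindowBounded x w rate' :=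
  fun s e => (h s e).trans (mul_le_mul_of_nonneg_left hr (Nat.cast_nonneg w))

/-- A frame is tiled exactly by `n` windows, so its arrivals never exceed the capacity, and no frame
starts with more than it can clear. -/
theorem framed_adversariallyStable {w : ℕ} (hw : 0 < w) {rate : ℝ} (h0 : 0 ≤ rate) {n : ℕ}
    (hn : 0 < n) (hr : ((n * w : ℕ) : ℝ) * rate + m ≤ (n * w : ℕ)) :
    AdversariallyStable (framed (roundRobinWithholding m) (n * w)) w rate := by
  have hT : 0 < n * w := Nat.mul_pos hn hw
  have hm : m ≤ n * w := by
    have : (m : ℝ) ≤ (n * w : ℕ) := by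
      have : 0 ≤ ((n * w : ℕ) : ℝ) * rate := by positivity
      linarith
    exact_mod_cast this
  refine ⟨2 * (n * w), fun G x hx => ?_⟩
  have hA : ∀ k, x.frameArrivals (n * w) k ≤ n * w - m := by
    intro k
    have h1 := hx.sum_arrivals_mul_le h0 (k * (n * w)) n
    rw [Injection.frameArrivals, Nat.succ_mul]
    have h2 : ((∑ t ∈ Finset.Ico (k * (n * w)) (k * (n * w) + n * w), x.arrivals t + m : ℕ) : ℝ) ≤
        (n * w : ℕ) := by
      rw [Nat.cast_add]
      linarith
    have h3 : ∑ t ∈ Finset.Ico (k * (n * w)) (k * (n * w) + n * w), x.arrivals t + m ≤ n * w := by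
      exact_mod_cast h2
    omega
  have hB : ∀ k, backlog (framed (roundRobinWithholding m) (n * w)) x (k * (n * w)) ≤
      n * w - m := by
    intro k
    induction k with
    | zero => simp [backlog, dynamics, run]
    | succ k ih =>
      have := framed_backlog_succ_le hT hm x k
      have := hA k
      omega
  refine ⟨fun t => ?_, fun t g _ => ?_⟩
  · have := framed_backlog_le hT x t
    have := hA (t / (n * w))
    have := hB (t / (n * w))
    omega
  · have ht : t < (t / (n * w) + 1) * (n * w) := by
      have := Nat.div_add_mod' t (n * w)
      have := Nat.mod_lt t hT
      rw [Nat.succ_mul]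
      omega
    refine (framed_latency_le hT x (t / (n * w) + 1) (hB _) hm ht g).trans ?_
    have : (t / (n * w) + 1 + 1) * (n * w) - t ≤ 2 * (n * w) := by
      have := Nat.div_mul_le_self t (n * w)
      have : (t / (n * w) + 1 + 1) * (n * w) = t / (n * w) * (n * w) + 2 * (n * w) := by ring
      omega
    exact_mod_cast this

/-! ### Stochastic injection -/

section

variable {Ω : Type*} [MeasurableSpace Ω] {μ : Measure Ω} {G : ℕ}
  {X : ℕ → Fin G → Ω → Option (Fin m)} {rate : ℝ}

theorem IsStochasticInjection.mono {rate' : ℝ} (h : IsStochasticInjection μ X rate)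
    (hr : rate ≤ rate') : IsStochasticInjection μ X rate' :=
  ⟨h.measurable, h.identDistrib, h.indep, fun t e => (h.rate_le t e).trans hr⟩

theorem IsStochasticInjection.measurableSet (h : IsStochasticInjection μ X rate) (t : ℕ)
    (g : Fin G) : MeasurableSet {ω | X t g ω ≠ none} :=
  @h.measurable t g {o | o ≠ none} trivial

theorem IsStochasticInjection.sum_measureReal_le [IsFiniteMeasure μ]
    (h : IsStochasticInjection μ X rate) (hr : 0 ≤ rate) (t : ℕ) :
    ∑ g, μ.real {ω | X t g ω ≠ none} ≤ rate := by
  have hle : ∑ g, μ.real {ω | X t g ω ≠ none} ≤ ∑ g, ∑ i, μ.real {ω | X t g ω = some i} := by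
    refine Finset.sum_le_sum fun g _ => ?_
    refine le_trans (measureReal_mono ?_) (measureReal_iUnion_fintype_le _)
    intro ω hω
    obtain ⟨i, hi⟩ := Option.ne_none_iff_exists'.1 hω
    exact Set.mem_iUnion.2 ⟨i, hi⟩
  refine hle.trans ?_
  rcases Nat.eq_zero_or_pos m with rfl | hm
  · simpa using hr
  · have := h.rate_le t ⟨0, hm⟩
    simp only [interference, Matrix.mulVec, dotProduct, one_mul] at this
    rwa [Finset.sum_comm]

/-- The weight of an injection: `a` if there is a packet, `1` otherwise. -/
noncomputable def packetWeight (a : ℝ) (o : Option (Fin m)) : ℝ≥0∞ :=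
  if o = none then 1 else ENNReal.ofReal a

theorem IsStochasticInjection.measurable_comp (h : IsStochasticInjection μ X rate)
    (f : Option (Fin m) → ℝ≥0∞) (t : ℕ) (g : Fin G) : Measurable fun ω => f (X t g ω) :=
  @Measurable.comp _ _ _ _ ⊤ _ _ _ measurable_from_top (h.measurable t g)

/-- The function may vary with the index, so that one factor can be the indicator of a conditioning
event. -/
theorem IsStochasticInjection.lintegral_prod (h : IsStochasticInjection μ X rate)
    (f : ℕ × Fin G → Option (Fin m) → ℝ≥0∞) (S : Finset (ℕ × Fin G)) :
    ∫⁻ ω, ∏ p ∈ S, f p (X p.1 p.2 ω) ∂μ = ∏ p ∈ S, ∫⁻ ω, f p (X p.1 p.2 ω) ∂μ :=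
  lintegral_prod_eq_prod_lintegral_of_indepFun S (fun p ω => f p (X p.1 p.2 ω))
    (iIndepFun.comp (mβ := fun _ => ⊤) h.indep f fun _ => measurable_from_top)
    fun p => h.measurable_comp (f p) p.1 p.2

theorem IsStochasticInjection.lintegral_packetWeight_le [IsProbabilityMeasure μ]
    (h : IsStochasticInjection μ X rate) {a : ℝ} (ha : 1 ≤ a) (t : ℕ) (g : Fin G) :
    ∫⁻ ω, packetWeight a (X t g ω) ∂μ ≤
      ENNReal.ofReal (Real.exp ((a - 1) * μ.real {ω | X t g ω ≠ none})) := by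
  have heq : ∀ ω, packetWeight a (X t g ω) =
      1 + Set.indicator {ω | X t g ω ≠ none} (fun _ => ENNReal.ofReal (a - 1)) ω := by
    intro ω
    unfold packetWeight
    by_cases hω : X t g ω = none
    · rw [if_pos hω, Set.indicator_of_notMem (not_not.2 hω), add_zero]
    · rw [if_neg hω, Set.indicator_of_mem (show ω ∈ {ω | X t g ω ≠ none} from hω),
        ← ENNReal.ofReal_one, ← ENNReal.ofReal_add zero_le_one (sub_nonneg.2 ha)]
      congr 1
      ring
  simp only [heq]
  rw [lintegral_add_left measurable_const, lintegral_const, measure_univ, mul_one,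
    lintegral_indicator (h.measurableSet t g), setLIntegral_const, ← ofReal_measureReal,
    ← ENNReal.ofReal_mul (sub_nonneg.2 ha), ← ENNReal.ofReal_one,
    ← ENNReal.ofReal_add zero_le_one (mul_nonneg (sub_nonneg.2 ha) measureReal_nonneg)]
  refine ENNReal.ofReal_le_ofReal ?_
  linarith [Real.add_one_le_exp ((a - 1) * μ.real {ω | X t g ω ≠ none})]

theorem IsStochasticInjection.prod_lintegral_packetWeight_le [IsProbabilityMeasure μ]
    (h : IsStochasticInjection μ X rate) {a : ℝ} (ha : 1 ≤ a) (S : Finset (ℕ × Fin G)) :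
    ∏ p ∈ S, ∫⁻ ω, packetWeight a (X p.1 p.2 ω) ∂μ ≤
      ENNReal.ofReal (Real.exp ((a - 1) * ∑ p ∈ S, μ.real {ω | X p.1 p.2 ω ≠ none})) := by
  rw [Finset.mul_sum, Real.exp_sum, ENNReal.ofReal_prod_of_nonneg fun _ _ => (Real.exp_pos _).le]
  exact Finset.prod_le_prod' fun p _ => h.lintegral_packetWeight_le ha p.1 p.2

theorem IsStochasticInjection.setLIntegral_prod_packetWeight_le [IsProbabilityMeasure μ]
    (h : IsStochasticInjection μ X rate) {a : ℝ} (ha : 1 ≤ a) (S : Finset (ℕ × Fin G)) (t : ℕ)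
    (g : Fin G) :
    ∫⁻ ω in {ω | X t g ω ≠ none}, ∏ p ∈ S, packetWeight a (X p.1 p.2 ω) ∂μ ≤
      ENNReal.ofReal a * (μ {ω | X t g ω ≠ none} * ENNReal.ofReal
        (Real.exp ((a - 1) * ∑ p ∈ S, μ.real {ω | X p.1 p.2 ω ≠ none}))) := by
  classical
  -- On the event, the factor at `(t, g)` is `a` or absent, hence at most `a`; replacing it by the
  -- indicator keeps a product of independent factors.
  let f : ℕ × Fin G → Option (Fin m) → ℝ≥0∞ := fun p o =>
    if p = (t, g) then (if o = none then 0 else 1) else packetWeight a o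
  have hf : ∀ p ∈ S.erase (t, g), ∀ o, f p o = packetWeight a o := fun p hp o =>
    if_neg (Finset.ne_of_mem_erase hp)
  have hprod : ∀ F : ℕ × Fin G → ℝ≥0∞, ∏ p ∈ insert (t, g) (S.erase (t, g)), F p =
      F (t, g) * ∏ p ∈ S.erase (t, g), F p := fun F =>
    Finset.prod_insert (Finset.notMem_erase _ _)
  rw [← lintegral_indicator (h.measurableSet t g)]
  calc ∫⁻ ω, Set.indicator {ω | X t g ω ≠ none}
        (fun ω => ∏ p ∈ S, packetWeight a (X p.1 p.2 ω)) ω ∂μ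
      ≤ ∫⁻ ω, ENNReal.ofReal a *
          ∏ p ∈ insert (t, g) (S.erase (t, g)), f p (X p.1 p.2 ω) ∂μ := by
        refine lintegral_mono fun ω => ?_
        by_cases hω : X t g ω = none
        · rw [Set.indicator_of_notMem (not_not.2 hω)]
          exact zero_le
        · rw [Set.indicator_of_mem (show ω ∈ {ω | X t g ω ≠ none} from hω), hprod,
            Finset.prod_congr rfl fun p hp => hf p hp (X p.1 p.2 ω)]
          have h1 : f (t, g) (X t g ω) = 1 := by simp only [f, if_true, if_neg hω]
          rw [h1, one_mul]
          by_cases hS : (t, g) ∈ S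
          · rw [← Finset.mul_prod_erase S _ hS]
            simp only [packetWeight, if_neg hω]
            exact le_rfl
          · rw [Finset.erase_eq_of_notMem hS]
            exact le_mul_of_one_le_left' (ENNReal.one_le_ofReal.2 ha)
    _ = ENNReal.ofReal a * (μ {ω | X t g ω ≠ none} *
          ∏ p ∈ S.erase (t, g), ∫⁻ ω, packetWeight a (X p.1 p.2 ω) ∂μ) := by
        rw [lintegral_const_mul' _ _ ENNReal.ofReal_ne_top, h.lintegral_prod, hprod,
          Finset.prod_congr rfl fun p hp => lintegral_congr fun ω => hf p hp (X p.1 p.2 ω)]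
        congr 2
        rw [← lintegral_indicator_one (h.measurableSet t g)]
        refine lintegral_congr fun ω => ?_
        by_cases hω : X t g ω = none
        · rw [Set.indicator_of_notMem (not_not.2 hω)]
          simp [f, hω]
        · rw [Set.indicator_of_mem (show ω ∈ {ω | X t g ω ≠ none} from hω)]
          simp [f, hω]
    _ ≤ _ := by
        refine mul_le_mul_right (mul_le_mul_right
          ((h.prod_lintegral_packetWeight_le ha _).trans ?_) _) _
        refine ENNReal.ofReal_le_ofReal (Real.exp_le_exp.2
          (mul_le_mul_of_nonneg_left ?_ (sub_nonneg.2 ha)))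
        exact Finset.sum_le_sum_of_subset_of_nonneg (Finset.erase_subset _ _)
          fun _ _ _ => measureReal_nonneg

/-- The exponential turns the arrival count into a product over slots and generators, the form to
which independence applies. -/
theorem excessWeight_eq (θ : ℝ) (c T : ℕ) (x : Injection m G) (j l : ℕ) :
    excessWeight θ c T x j l = ENNReal.ofReal (Real.exp (-(θ * c * ((l - j : ℕ) : ℝ)))) *
      ∏ p ∈ Finset.Ico (j * T) (l * T) ×ˢ Finset.univ,
        packetWeight (Real.exp θ) (x p.1 p.2) := by
  have h : ∀ t, ∏ g, packetWeight (Real.exp θ) (x t g) =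
      ENNReal.ofReal (Real.exp (θ * x.arrivals t)) := by
    intro t
    simp only [packetWeight]
    rw [Finset.prod_ite, Finset.prod_const_one, one_mul, Finset.prod_const,
      ← ENNReal.ofReal_pow (Real.exp_pos _).le, ← Real.exp_nat_mul, mul_comm]
    rfl
  rw [Finset.prod_product, Finset.prod_congr rfl fun t _ => h t,
    ← ENNReal.ofReal_prod_of_nonneg fun _ _ => (Real.exp_pos _).le, ← Real.exp_sum,
    ← ENNReal.ofReal_mul (Real.exp_pos _).le, ← Real.exp_add, excessWeight, ← Finset.mul_sum]
  congr 2
  push_cast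
  ring

theorem IsStochasticInjection.measurable_excessWeight (h : IsStochasticInjection μ X rate)
    (θ : ℝ) (c T j l : ℕ) :
    Measurable fun ω => excessWeight θ c T (fun s g => X s g ω) j l := by
  simp only [excessWeight_eq]
  exact (Finset.measurable_fun_prod _ fun p _ =>
    h.measurable_comp (packetWeight (Real.exp θ)) p.1 p.2).const_mul _

theorem IsStochasticInjection.sum_product_measureReal_le [IsFiniteMeasure μ]
    (h : IsStochasticInjection μ X rate) (hr : 0 ≤ rate) (T j l : ℕ) :
    ∑ p ∈ Finset.Ico (j * T) (l * T) ×ˢ Finset.univ, μ.real {ω | X p.1 p.2 ω ≠ none} ≤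
      ((l - j : ℕ) : ℝ) * (T * rate) := by
  rw [Finset.sum_product]
  refine (Finset.sum_le_card_nsmul _ _ rate fun t _ => h.sum_measureReal_le hr t).trans ?_
  rw [Nat.card_Ico, ← Nat.sub_mul, nsmul_eq_mul]
  push_cast
  exact (mul_assoc _ _ _).le

/-- The bound on the mean excess weight for each frame. -/
noncomputable def decay (θ : ℝ) (c T : ℕ) (rate : ℝ) : ℝ≥0∞ :=
  ENNReal.ofReal (Real.exp ((Real.exp θ - 1) * (T * rate) - θ * c))

theorem ofReal_exp_mul_le_decay {θ : ℝ} (hθ : 0 ≤ θ) (c T n : ℕ) {s : ℝ}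
    (hs : s ≤ n * (T * rate)) :
    ENNReal.ofReal (Real.exp (-(θ * c * n))) * ENNReal.ofReal (Real.exp ((Real.exp θ - 1) * s)) ≤
      decay θ c T rate ^ n := by
  rw [decay, ← ENNReal.ofReal_mul (Real.exp_pos _).le, ← Real.exp_add,
    ← ENNReal.ofReal_pow (Real.exp_pos _).le, ← Real.exp_nat_mul]
  refine ENNReal.ofReal_le_ofReal (Real.exp_le_exp.2 ?_)
  have := mul_le_mul_of_nonneg_left hs (sub_nonneg.2 (Real.one_le_exp hθ))
  linarith

theorem IsStochasticInjection.lintegral_excessWeight_le [IsProbabilityMeasure μ]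
    (h : IsStochasticInjection μ X rate) (hr : 0 ≤ rate) {θ : ℝ} (hθ : 0 ≤ θ) (c T j l : ℕ) :
    ∫⁻ ω, excessWeight θ c T (fun s g => X s g ω) j l ∂μ ≤ decay θ c T rate ^ (l - j) := by
  simp only [excessWeight_eq]
  rw [lintegral_const_mul' _ _ ENNReal.ofReal_ne_top,
    h.lintegral_prod fun _ => packetWeight (Real.exp θ)]
  exact (mul_le_mul_right (h.prod_lintegral_packetWeight_le (Real.one_le_exp hθ) _) _).trans
    (ofReal_exp_mul_le_decay hθ c T (l - j) (h.sum_product_measureReal_le hr T j l))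

theorem IsStochasticInjection.lintegral_cond_excessWeight_le [IsProbabilityMeasure μ]
    (h : IsStochasticInjection μ X rate) (hr : 0 ≤ rate) {θ : ℝ} (hθ : 0 ≤ θ) (c T j l t : ℕ)
    (g : Fin G) :
    ∫⁻ ω, excessWeight θ c T (fun s g => X s g ω) j l ∂(μ[|{ω | X t g ω ≠ none}]) ≤
      ENNReal.ofReal (Real.exp θ) * decay θ c T rate ^ (l - j) := by
  simp only [excessWeight_eq]
  rw [lintegral_const_mul' _ _ ENNReal.ofReal_ne_top, ProbabilityTheory.cond,
    lintegral_smul_measure, smul_eq_mul]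
  set E := μ {ω | X t g ω ≠ none}
  refine (mul_le_mul_right (mul_le_mul_right (h.setLIntegral_prod_packetWeight_le
    (Real.one_le_exp hθ) _ t g) _) _).trans ?_
  have hd := ofReal_exp_mul_le_decay hθ c T (l - j) (h.sum_product_measureReal_le hr T j l)
  set K := ENNReal.ofReal (Real.exp (-(θ * c * ((l - j : ℕ) : ℝ))))
  set a := ENNReal.ofReal (Real.exp θ)
  set F := ENNReal.ofReal (Real.exp ((Real.exp θ - 1) *
    ∑ p ∈ Finset.Ico (j * T) (l * T) ×ˢ Finset.univ, μ.real {ω | X p.1 p.2 ω ≠ none}))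
  -- Only `E⁻¹ * E ≤ 1` is available, as the conditioning event may be null.
  calc K * (E⁻¹ * (a * (E * F))) = (E⁻¹ * E) * (a * (K * F)) := by ring
    _ ≤ 1 * (a * decay θ c T rate ^ (l - j)) :=
      mul_le_mul' (ENNReal.inv_mul_le_one E) (mul_le_mul_right hd a)
    _ = _ := one_mul _

end

/-! ### Geometric series, choice of exponent and frame length -/

theorem sum_range_pow_sub_le (ρ : ℝ≥0∞) (k r : ℕ) :
    ∑ j ∈ Finset.range (k + 1), ρ ^ (k + 1 + r - j) ≤ ρ ^ r * (1 - ρ)⁻¹ := by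
  calc ∑ j ∈ Finset.range (k + 1), ρ ^ (k + 1 + r - j)
      = ∑ j ∈ Finset.range (k + 1), ρ ^ r * (ρ * ρ ^ j) := by
        rw [← Finset.sum_range_reflect]
        refine Finset.sum_congr rfl fun j hj => ?_
        have := Finset.mem_range.1 hj
        rw [← pow_succ', ← pow_add]
        congr 1
        omega
    _ = ρ ^ r * ∑ j ∈ Finset.range (k + 1), ρ ^ (j + 1) := by
        simp only [← pow_succ', Finset.mul_sum]
    _ ≤ ρ ^ r * ∑ j ∈ Finset.range (k + 2), ρ ^ j := by
        rw [Finset.sum_range_succ' _ (k + 1)]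
        exact mul_le_mul_right le_self_add _
    _ ≤ ρ ^ r * ∑' j, ρ ^ j := mul_le_mul_right (ENNReal.sum_le_tsum _) _
    _ = _ := by rw [ENNReal.tsum_geometric]

/-- A positive exponent for which the exponential weight decays. -/
theorem exists_exponent {s c : ℝ} (hs : 0 ≤ s) (hc : s < c) :
    ∃ θ, 0 < θ ∧ (Real.exp θ - 1) * s - θ * c < 0 := by
  -- For `θ ≤ 1`, `exp θ - 1 ≤ θ + θ ^ 2`, so `s + θ * s < c` is enough; dividing by `s + 1` makes
  -- this strict and allows `s = 0`.
  refine ⟨min 1 ((c - s) / (s + 1)), lt_min one_pos (div_pos (sub_pos.2 hc) (by linarith)), ?_⟩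
  set θ := min 1 ((c - s) / (s + 1))
  have hpos : 0 < θ := lt_min one_pos (div_pos (sub_pos.2 hc) (by linarith))
  have h1 : |θ| ≤ 1 := by rw [abs_of_pos hpos]; exact min_le_left _ _
  have h2 : θ * (s + 1) ≤ c - s := (le_div_iff₀ (by linarith)).1 (min_le_right _ _)
  have h3 := (abs_le.1 (Real.abs_exp_sub_one_sub_id_le h1)).2
  have h4 : (Real.exp θ - 1) * s ≤ (θ + θ ^ 2) * s :=
    mul_le_mul_of_nonneg_right (by linarith) hs
  have h5 : θ * (s + θ * s) < θ * c := mul_lt_mul_of_pos_left (by linarith) hpos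
  nlinarith

theorem framed_stochasticallyStable {T : ℕ} (hT : 0 < T) {rate : ℝ} (h0 : 0 ≤ rate)
    (hr : (T : ℝ) * rate + m < T) :
    StochasticallyStable.{u} (framed (roundRobinWithholding m) T) rate := by
  have hm : m ≤ T := by
    have : (m : ℝ) ≤ T := by
      have : 0 ≤ (T : ℝ) * rate := by positivity
      linarith
    exact_mod_cast this
  obtain ⟨θ, hθ, hneg⟩ := exists_exponent (s := T * rate) (c := ((T - m : ℕ) : ℝ))
    (by positivity) (by rw [Nat.cast_sub hm]; linarith)
  set ρ := decay θ (T - m) T rate with hρ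
  have hρ1 : ρ < 1 := by
    rw [hρ, decay, ENNReal.ofReal_lt_one]
    exact Real.exp_lt_one_iff.2 hneg
  have hfin : (1 - ρ)⁻¹ ≠ ⊤ := ENNReal.inv_ne_top.2 (tsub_pos_of_lt hρ1).ne'
  set C₁ : ℝ≥0∞ := 2 * T + ENNReal.ofReal θ⁻¹ * (1 - ρ)⁻¹ with hC₁
  set C₂ : ℝ≥0∞ := T * (2 + ENNReal.ofReal (Real.exp θ) * ((1 - ρ)⁻¹ * (1 - ρ)⁻¹)) with hC₂
  have hC₁f : C₁ ≠ ⊤ := by finiteness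
  have hC₂f : C₂ ≠ ⊤ := by finiteness
  -- `C₁` bounds the mean backlog and `C₂` the mean latency; neither involves the injection process.
  -- The two factors `(1 - ρ)⁻¹` in `C₂` come from summing over busy-period starts and over later
  -- frames.
  obtain ⟨B, hB⟩ := ENNReal.exists_nat_gt (ENNReal.add_ne_top.2 ⟨hC₁f, hC₂f⟩)
  refine ⟨B, fun Ω _ μ _ G X hX => ⟨fun t => ?_, fun t g => ?_⟩⟩
  · refine le_trans ?_ (le_self_add.trans hB.le)
    calc ∫⁻ ω, (backlog (framed (roundRobinWithholding m) T) (fun s g => X s g ω) t : ℝ≥0∞) ∂μ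
        ≤ ∫⁻ ω, (2 * T + ENNReal.ofReal θ⁻¹ * ∑ j ∈ Finset.range (t / T + 1),
            excessWeight θ (T - m) T (fun s g => X s g ω) j (t / T + 1)) ∂μ :=
          lintegral_mono fun ω => le_trans (Nat.cast_le.2 (framed_backlog_le hT _ t))
            (framed_frame_load_le hT hm hθ _ _)
      _ = 2 * T + ENNReal.ofReal θ⁻¹ * ∑ j ∈ Finset.range (t / T + 1),
            ∫⁻ ω, excessWeight θ (T - m) T (fun s g => X s g ω) j (t / T + 1) ∂μ := by
          rw [lintegral_add_left measurable_const, lintegral_const, measure_univ, mul_one,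
            lintegral_const_mul' _ _ ENNReal.ofReal_ne_top,
            lintegral_finsetSum _ fun j _ => hX.measurable_excessWeight θ (T - m) T j (t / T + 1)]
      _ ≤ C₁ := by
          refine add_le_add_right (mul_le_mul_right ?_ _) _
          refine (Finset.sum_le_sum fun j _ => hX.lintegral_excessWeight_le h0 hθ.le (T - m) T j
            (t / T + 1)).trans ?_
          simpa using sum_range_pow_sub_le ρ (t / T) 0
  · refine le_trans ?_ (le_add_self.trans hB.le)
    have hone : (μ[|{ω | X t g ω ≠ none}]) Set.univ ≤ 1 := by
      rw [ProbabilityTheory.cond, Measure.smul_apply, Measure.restrict_apply_univ, smul_eq_mul]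
      exact ENNReal.inv_mul_le_one _
    calc ∫⁻ ω, ((latency (framed (roundRobinWithholding m) T) (fun s g' => X s g' ω) t g : ℕ∞)
          : ℝ≥0∞) ∂(μ[|{ω | X t g ω ≠ none}])
        ≤ ∫⁻ ω, (T * (2 + ∑' r, ∑ j ∈ Finset.range (t / T + 1),
            excessWeight θ (T - m) T (fun s g' => X s g' ω) j (t / T + 1 + r)))
              ∂(μ[|{ω | X t g ω ≠ none}]) :=
          lintegral_mono fun ω => framed_latency_le_tsum hT hm hθ _ t g
      _ = T * (2 * (μ[|{ω | X t g ω ≠ none}]) Set.univ +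
            ∑' r, ∑ j ∈ Finset.range (t / T + 1),
              ∫⁻ ω, excessWeight θ (T - m) T (fun s g' => X s g' ω) j (t / T + 1 + r)
                ∂(μ[|{ω | X t g ω ≠ none}])) := by
          have hme := fun j r => hX.measurable_excessWeight θ (T - m) T j (t / T + 1 + r)
          rw [lintegral_const_mul' _ _ (ENNReal.natCast_ne_top T),
            lintegral_add_left measurable_const, lintegral_const, lintegral_tsum fun r =>
              (Finset.measurable_fun_sum _ fun j _ => hme j r).aemeasurable]
          congr 3
          funext r
          rw [lintegral_finsetSum _ fun j _ => hme j r]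
      _ ≤ T * (2 * 1 + ∑' r, ENNReal.ofReal (Real.exp θ) * (ρ ^ r * (1 - ρ)⁻¹)) := by
          refine mul_le_mul_right (add_le_add (mul_le_mul_right hone _)
            (ENNReal.tsum_le_tsum fun r => ?_)) _
          refine (Finset.sum_le_sum fun j _ => hX.lintegral_cond_excessWeight_le h0 hθ.le (T - m)
            T j (t / T + 1 + r) t g).trans ?_
          rw [← Finset.mul_sum]
          exact mul_le_mul_right (sum_range_pow_sub_le ρ (t / T) r) _
      _ = C₂ := by
          rw [ENNReal.tsum_mul_left, ENNReal.tsum_mul_right, ENNReal.tsum_geometric, mul_one]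

theorem StochasticallyStable.mono {P : Protocol m} {rate rate' : ℝ}
    (h : StochasticallyStable.{u} P rate') (hr : rate ≤ rate') : StochasticallyStable.{u} P rate :=
  h.imp fun _ hB Ω _ μ _ G X hX => hB Ω μ G X (hX.mono hr)

theorem AdversariallyStable.mono {P : Protocol m} {w : ℕ} {rate rate' : ℝ}
    (h : AdversariallyStable P w rate') (hr : rate ≤ rate') : AdversariallyStable P w rate :=
  h.imp fun _ hB G x hx => hB G x (hx.mono hr)

/-- The slack `T * (1 - rate)` eventually exceeds `m`. All large `T` are covered, so that a multiple
of `w` can be taken. -/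
theorem exists_frame_length {rate : ℝ} (hrate : rate < 1) (m : ℕ) :
    ∃ n : ℕ, 0 < n ∧ ∀ T : ℕ, n ≤ T → (T : ℝ) * rate + m < T := by
  obtain ⟨n, hn⟩ := exists_nat_gt ((m : ℝ) / (1 - rate))
  have hpos : 0 < 1 - rate := sub_pos.2 hrate
  refine ⟨n, ?_, fun T hT => ?_⟩
  · have : (0 : ℝ) < n := (div_nonneg (Nat.cast_nonneg m) hpos.le).trans_lt hn
    exact_mod_cast this
  · have h1 : (m : ℝ) / (1 - rate) < T := hn.trans_le (by exact_mod_cast hT)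
    rw [div_lt_iff₀ hpos] at h1
    linarith

end MAC

theorem mainTheorem10 (m : ℕ) (rate : ℝ) (hrate : rate < 1) :
    -- the static algorithm delivers any `n` packets in `n + m` steps
    (∀ (α : Type) (q : Fin m → List α),
      MAC.DeliversWithin (MAC.roundRobinWithholding m) q ((∑ i, (q i).length) + m)) ∧
    -- a protocol using it that is stable under stochastic injection
    (∃ P : MAC.Protocol m,
      (∃ T : ℕ, 0 < T ∧ P = MAC.framed (MAC.roundRobinWithholding m) T) ∧
        MAC.StochasticallyStable.{u} P rate) ∧
    -- a protocol using it that is stable under adversarial injection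
    (∀ w : ℕ, 0 < w → ∃ P : MAC.Protocol m,
      (∃ T : ℕ, 0 < T ∧ P = MAC.framed (MAC.roundRobinWithholding m) T) ∧
        MAC.AdversariallyStable P w rate) := by
  -- The rate may be negative; the stability results are applied to `max rate 0` and transferred by
  -- monotonicity.
  obtain ⟨n, hn, hT⟩ := MAC.exists_frame_length (max_lt hrate one_pos) m
  refine ⟨fun α q => MAC.roundRobinWithholding_deliversWithin q, ⟨_, ⟨n, hn, rfl⟩, ?_⟩,
    fun w hw => ⟨_, ⟨n * w, Nat.mul_pos hn hw, rfl⟩, ?_⟩⟩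
  · exact (MAC.framed_stochasticallyStable hn (le_max_right rate 0) (hT n le_rfl)).mono
      (le_max_left rate 0)
  · exact (MAC.framed_adversariallyStable hw (le_max_right rate 0) hn
      (hT (n * w) (Nat.le_mul_of_pos_right n hw)).le).mono (le_max_left rate 0)
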